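/- Let $D\in\mathbb{R}^{m\times n}$, $m\ge n$, $\mathrm{rank}\,D=n-1$ (kinematic matrix), $A=\mathrm{diag}(a_1,\dots,a_m)$ with all $a_j>0$ (stiffnesses), $c_j^-\le c_j^+$ for $1\le j\le m$ (elastic limits), $R\in\mathbb{R}^m$ with $\mathrm{rank}(D^TR)=1$, and $l:[0,\infty)\to\mathbb{R}$ Lipschitz continuous (displacement-controlled loading). Put $d=m-n+2$, $\langle x,y\rangle_A=\langle x,Ay\rangle$, $\|x\|^A=\sqrt{\langle x,Ax\rangle}$. Let $M$ be an $n\times(n-2)$-matrix with $\mathrm{rank}(DM)=n-2$ and $R^TDM=0$, let $\mathcal V_{basis}$ be an $m\times d$-matrix of rank $d$ with $(DM)^TA\mathcal V_{basis}=0$, and let $D^\perp$ be an $m\times(m-n+1)$-matrix of rank $m-n+1$ with $(D^\perp)^TD=0$. Put $$\mathcal V=\mathcal V_{basis}\mathbb{R}^d,\quad G=\begin{pmatrix}R^T\\(D^\perp)^T\end{pmatrix},\quad W=G\mathcal V_{basis},\quad \bar L=W^{-1}\begin{pmatrix}1\\0_{m-n+1}\end{pmatrix},\quad c(t)=-\mathcal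 V_{basis}\bar L\,l(t),\quad n_j=\mathcal V_{basis}W^{-1}Ge_j,$$ $$C=\{y\in\mathcal V:\ c_j^-\le\langle e_j,Ay\rangle\le c_j^+,\ 1\le j\le m\},\qquad C(t)=C+c(t).$$ For $K\subset\mathcal V$ let $N^A_K(y)=\{x\in\mathcal V:\langle x,A(\xi-y)\rangle\le0\ \text{for all}\ \xi\in K\}$ if $y\in K$ and $N^A_K(y)=\emptyset$ otherwise. A solution of the sweeping process on $[t_0,\infty)$ is a locally absolutely continuous $y:[t_0,\infty)\to\mathcal V$ with $y(t)\in C(t)$ for all $t\ge t_0$ and $-\dot y(t)\in N^A_{C(t)}(y(t))$ for a.a. $t\ge t_0$; the associated stress trajectory is the function $s$ given by $y(t)=A^{-1}s(t)+c(t)$. Let $I_0\subset\{-1,1\}\times\{1,\dots,m\}$ have exactly $d$ elements, write $c_j^{+1}=c_j^+$, $c_j^{-1}=c_j^-$, and let $y_{*,0}$ belong to $F=\{y\in\mathcal V:\langle e_j,Ay\rangle=c_j^\alpha,\ (\alpha,j)\in I_0\}$. Assume that $c_j^-<\langle e_j,Ay_{*,0}\rangle<c_j^+$ for every $j$ such that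 neither $(1,j)$ nor $(-1,j)$ is in $I_0$. Let $\varepsilon_0>0$ and $\tau_d$ be real numbers such that for a.a. $t\in[0,\tau_d]$ $$\begin{pmatrix}1\\0_{m-n+1}\end{pmatrix}l'(t)\in\mathrm{cone}\bigl(G\{\alpha e_j:(\alpha,j)\in I_0\}\bigr)\quad\text{and}\quad\varepsilon_0\le\mathrm{dist}^A\bigl(-c'(t),\partial\,\mathrm{cone}\{\alpha n_j:(\alpha,j)\in I_0\}\bigr),$$ where $\partial$ is the boundary in $\mathcal V$ and $\mathrm{dist}^A$ is the distance in the norm $\|\cdot\|^A$, and such that $$\tau_d\ge\frac1{\varepsilon_0}\,\|A^{-1}c^+-A^{-1}c^-\|^A .$$ Then: 1. $F=\{y_{*,0}\}$, and for a.a. $t\in[0,\tau_d]$ and all $y\in F$ one has $-c'(t)+B^A_{\varepsilon_0}(0)\cap N_F^A(y)\subset N_C^A(y)$, where $B^A_{\varepsilon_0}(0)$ is the closed ball of radius $\varepsilon_0$ in the norm $\|\cdot\|^A$. 2. Every solution $y$ on $[0,\infty)$, with any $y(0)\in C(0)$, satisfies $y(\tau_d)=y_{*,0}+c(\tau_d)$;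 every stress trajectory on $[0,\infty)$ satisfies $s(\tau_d)=Ay_{*,0}$, regardless of $s(0)$. 3. If $c$ is $T$-periodic on $[0,\infty)$ with $T>0$ and $T\ge\tau_d$, then there is a $T$-periodic solution $y_*$ on $[0,\infty)$ with $y_*(\tau_d)=y_{*,0}+c(\tau_d)$ that is one-period stable, i.e. it is Lyapunov stable and every solution on $[0,\infty)$ coincides with it for all $t\ge T$. It coincides on $[\tau_d,\infty)$ with every solution on $[\tau_d,\infty)$ that starts at $y_{*,0}+c(\tau_d)$ at time $\tau_d$, and with every solution on $[0,\infty)$, and it is the only $T$-periodic solution on $[0,\infty)$. Moreover, there is a $T$-periodic stress trajectory $s_*$ on $[0,\infty)$, and every stress trajectory on $[0,\infty)$ coincides with $s_*$ for all $t\ge\tau_d$. -/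

import Mathlib

open MeasureTheory Set

noncomputable section

/-- A connected network of `m` elastoplastic springs on `n` nodes with one displacement-controlled
loading. Only the rank condition of the kinematic matrix `D` matters, so `D` may be any real
matrix with that rank. -/
structure ElastoplasticSystem (m n : ℕ) where
  /-- kinematic matrix of the topology of the network -/
  D : Matrix (Fin m) (Fin n) ℝ
  /-- stiffnesses (Hooke's coefficients) -/
  a : Fin m → ℝ
  /-- lower elastic limits of the stresses -/
  cMinus : Fin m → ℝ
  /-- upper elastic limits of the stresses -/
  cPlus : Fin m → ℝ
  /-- location of the displacement-controlled loading -/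
  R : Fin m → ℝ
  /-- magnitude of the displacement-controlled loading; only its values on `[0, ∞)` matter -/
  l : ℝ → ℝ
  a_pos : ∀ j, 0 < a j
  limits_le : ∀ j, cMinus j ≤ cPlus j
  node_le_spring : n ≤ m
  rank_D : D.rank = n - 1
  rank_DtR : (D.transpose * Matrix.replicateCol (Fin 1) R).rank = 1
  lipschitz_l : ∃ K : NNReal, LipschitzOnWith K l (Ici 0)

namespace ElastoplasticSystem

variable {m n : ℕ} (S : ElastoplasticSystem m n)

/-- The diagonal matrix of stiffnesses. -/
def A : Matrix (Fin m) (Fin m) ℝ := Matrix.diagonal S.a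

/-- The scalar product `⟨x, A y⟩`. -/
def innerA (x y : Fin m → ℝ) : ℝ := dotProduct x (S.A.mulVec y)

/-- The norm `‖x‖^A`. -/
def normA (x : Fin m → ℝ) : ℝ := Real.sqrt (S.innerA x x)

/-- The distance from a point to a (non-empty) set in the norm `‖·‖^A`. -/
def distA (x : Fin m → ℝ) (K : Set (Fin m → ℝ)) : ℝ :=
  sInf ((fun z => S.normA (x - z)) '' K)

/-- The matrices that turn the mechanical data into a sweeping process. -/
structure Reduction where
  M : Matrix (Fin n) (Fin (n - 2)) ℝ
  Vbasis : Matrix (Fin m) (Fin (m - n + 2)) ℝ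
  Dperp : Matrix (Fin m) (Fin (m - n + 1)) ℝ
  rank_DM : (S.D * M).rank = n - 2
  R_DM : Matrix.vecMul S.R (S.D * M) = 0
  rank_Vbasis : Vbasis.rank = m - n + 2
  orth_Vbasis : (S.D * M).transpose * S.A * Vbasis = 0
  Dperp_D : Dperp.transpose * S.D = 0
  rank_Dperp : Dperp.rank = m - n + 1

namespace Reduction

variable {S} (P : S.Reduction)

/-- The `(m - n + 2) × m` matrix with first row `Rᵀ` and the rows of `(D^⊥)ᵀ` below it. -/
def G : Matrix (Fin (m - n + 2)) (Fin m) ℝ :=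
  Matrix.of (Matrix.vecCons S.R P.Dperp.transpose)

/-- The square matrix `W`. -/
def W : Matrix (Fin (m - n + 2)) (Fin (m - n + 2)) ℝ := P.G * P.Vbasis

/-- The vector `(1, 0, …, 0)ᵀ`. -/
def e₀ : Fin (m - n + 2) → ℝ := Pi.single 0 1

/-- The vector `L̄ = W⁻¹ (1, 0, …, 0)ᵀ`. -/
def Lbar : Fin (m - n + 2) → ℝ := P.W⁻¹.mulVec (e₀ (m := m) (n := n))

/-- The phase space `𝒱 = 𝒱_basis ℝ^d`, `d = m - n + 2`. -/
def V : Submodule ℝ (Fin m → ℝ) := LinearMap.range P.Vbasis.mulVecLin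

/-- The shift `c(t) = - 𝒱_basis L̄ l(t)` of the moving constraint. -/
def c (t : ℝ) : Fin m → ℝ := -(S.l t • P.Vbasis.mulVec P.Lbar)

/-- The vectors `n_j = 𝒱_basis W⁻¹ (Rᵀ; (D^⊥)ᵀ) e_j`. -/
def normal (j : Fin m) : Fin m → ℝ :=
  P.Vbasis.mulVec (P.W⁻¹.mulVec (P.G.mulVec (Pi.single j 1)))

/-- The polyhedron `C = {y ∈ 𝒱 : c_j⁻ ≤ ⟨e_j, A y⟩ ≤ c_j⁺ for all j}`. -/
def C : Set (Fin m → ℝ) :=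
  {y | y ∈ P.V ∧ ∀ j, S.cMinus j ≤ S.A.mulVec y j ∧ S.A.mulVec y j ≤ S.cPlus j}

/-- The moving constraint `C(t) = C + c(t)`. -/
def Ct (t : ℝ) : Set (Fin m → ℝ) := (fun y => y + P.c t) '' P.C

/-- The normal cone in `𝒱` with the scalar product `⟨x, A y⟩`; it is empty off the set `K`. -/
def normalCone (K : Set (Fin m → ℝ)) (y : Fin m → ℝ) : Set (Fin m → ℝ) :=
  {x | y ∈ K ∧ x ∈ P.V ∧ ∀ ξ ∈ K, S.innerA x (ξ - y) ≤ 0}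

/-- `y` restricted to `[t₀, ∞)` is a solution of the sweeping process `-y' ∈ N_{C(t)}(y)`. -/
structure IsSolution (t₀ : ℝ) (y : ℝ → Fin m → ℝ) : Prop where
  absCont : ∀ b, t₀ ≤ b → AbsolutelyContinuousOnInterval y t₀ b
  mem : ∀ t, t₀ ≤ t → y t ∈ P.Ct t
  inclusion : ∀ᵐ t ∂(volume.restrict (Ici t₀)),
    ∃ v, HasDerivAt y v t ∧ -v ∈ P.normalCone (P.Ct t) (y t)

/-- `s` restricted to `[t₀, ∞)` is an evolution of the vector of stresses of the network, that is,
`y = A⁻¹ s + c = A⁻¹ s - 𝒱_basis L̄ l` solves the sweeping process. -/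
def IsStress (t₀ : ℝ) (s : ℝ → Fin m → ℝ) : Prop :=
  P.IsSolution t₀ (fun t => S.A⁻¹.mulVec (s t) + P.c t)

end Reduction

/-- The elastic limit `c_j^α`; the signs `α = ±1` are the units of `ℤ`. -/
def limit (α : ℤˣ) (j : Fin m) : ℝ := if α = 1 then S.cPlus j else S.cMinus j

/-- Strict feasibility of `y` for the springs whose index does not occur in `I`. -/
def Feasible (I : Finset (ℤˣ × Fin m)) (y : Fin m → ℝ) : Prop :=
  ∀ j, (∀ α : ℤˣ, (α, j) ∉ I) → S.cMinus j < S.A.mulVec y j ∧ S.A.mulVec y j < S.cPlus j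

namespace Reduction

variable {S} (P : S.Reduction) (I : Finset (ℤˣ × Fin m))

/-- `F = {y ∈ 𝒱 : ⟨e_j, A y⟩ = c_j^α for all (α, j) ∈ I}`. -/
def F : Set (Fin m → ℝ) :=
  {y | y ∈ P.V ∧ ∀ p ∈ I, S.A.mulVec y p.2 = S.limit p.1 p.2}

/-- The cone generated by `α n_j`, `(α, j) ∈ I`. -/
def cone : Set (Fin m → ℝ) :=
  (PointedCone.hull ℝ ((fun p : ℤˣ × Fin m => ((p.1 : ℤ) : ℝ) • P.normal p.2) '' I) : Set _)

/-- The boundary of the cone generated by `α n_j`, `(α, j) ∈ I`, relative to the space `𝒱`. -/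
def coneBoundary : Set (Fin m → ℝ) :=
  (Subtype.val : P.V → Fin m → ℝ) '' frontier ((Subtype.val : P.V → Fin m → ℝ) ⁻¹' P.cone I)

/-- The inclusion `(1, 0, …, 0)ᵀ l'(t) ∈ cone((Rᵀ; (D^⊥)ᵀ){α e_j : (α, j) ∈ I})`. -/
def LoadingInCone (t : ℝ) : Prop :=
  deriv S.l t • (e₀ (m := m) (n := n)) ∈
    PointedCone.hull ℝ ((fun p : ℤˣ × Fin m =>
      P.G.mulVec (((p.1 : ℤ) : ℝ) • (Pi.single p.2 1 : Fin m → ℝ))) '' I)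

/-- The inclusion `-c'(t) + B_ε(0) ∩ N_K(y) ⊂ N_C(y)` for all `y ∈ K` and a.a. `t ∈ [0, τ]`,
with the closed ball `B_ε(0)` of the norm `‖·‖^A`. -/
def BallCondition (K : Set (Fin m → ℝ)) (ε τ : ℝ) : Prop :=
  ∀ᵐ t ∂(volume.restrict (Icc 0 τ)), ∀ y ∈ K, ∀ ζ ∈ P.normalCone K y,
    S.normA ζ ≤ ε → -deriv P.c t + ζ ∈ P.normalCone P.C y

/-- `y` is a (globally) one-period stable `T`-periodic solution on `[0, ∞)`: it is a `T`-periodic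
solution, it is Lyapunov stable, and every solution that starts at time `0` coincides with it from
the end of the first period on. -/
structure IsOnePeriodStable (T : ℝ) (y : ℝ → Fin m → ℝ) : Prop where
  solution : P.IsSolution 0 y
  periodic : ∀ t, 0 ≤ t → y (t + T) = y t
  stable : ∀ t₀, 0 ≤ t₀ → ∀ η, 0 < η → ∃ δ, 0 < δ ∧ ∀ z, P.IsSolution t₀ z →
    S.normA (z t₀ - y t₀) < δ → ∀ t, t₀ ≤ t → S.normA (z t - y t) < η
  one_period : ∀ z, P.IsSolution 0 z → ∀ t, T ≤ t → z t = y t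

end Reduction

end ElastoplasticSystem

end

/-! In the frame of the moving set put `x = y - c`. Each `n_j` is the `A`-orthogonal projection of
`e_j` onto `V`, so the cone of the `α n_j` consists of outward normals to `C` at `y₀`. The two
loading hypotheses put `-c'(t)` in this cone at distance at least `ε₀` from its boundary, hence the
`ε₀`-ball of `V` about `-c'(t)` lies in the normal cone at `y₀`. Applying this to the ball element
in the direction of `x - y₀`, and testing the sweeping inclusion with `y₀`, makes `‖x - y₀‖^A`
decrease at rate at least `ε₀` until it vanishes. The bound on `τ` leaves enough time for this,
because `C` lies in a box whose diagonal is `A⁻¹c⁺ - A⁻¹c⁻` (`add_mem_normalCone`,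
`IsSolution.eq_add_c`).

All solutions therefore meet at time `τ`, and stay together because the process is nonexpansive. One
solution shifted by a period is then periodic and attracts every other one by time `τ`. That some
solution exists is shown by the catch-up algorithm (`exists_sweeping`). -/

open Filter Topology RealInnerProductSpace in
theorem LipschitzWith.comp_absolutelyContinuousOnInterval {X Y : Type*} [PseudoMetricSpace X]
    [PseudoMetricSpace Y] {g : X → Y} {K : NNReal} (hg : LipschitzWith K g) {f : ℝ → X} {a b : ℝ}
    (hf : AbsolutelyContinuousOnInterval f a b) :
    AbsolutelyContinuousOnInterval (fun t => g (f t)) a b := by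
  refine squeeze_zero (fun t => Finset.sum_nonneg fun i _ => dist_nonneg) (fun t => ?_)
    (by simpa using Tendsto.const_mul (K : ℝ) hf)
  rw [Finset.mul_sum]
  exact Finset.sum_le_sum fun i _ => hg.dist_le_mul _ _

theorem AbsolutelyContinuousOnInterval.comp_add_const {X : Type*} [PseudoMetricSpace X]
    {f : ℝ → X} {a b : ℝ} (T : ℝ) (hf : AbsolutelyContinuousOnInterval f (a + T) (b + T)) :
    AbsolutelyContinuousOnInterval (fun t => f (t + T)) a b := by
  rw [absolutelyContinuousOnInterval_iff] at hf ⊢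
  intro ε hε
  obtain ⟨δ, hδ, h⟩ := hf ε hε
  refine ⟨δ, hδ, fun J hJ hs => ?_⟩
  refine h (J.1, fun i => ((J.2 i).1 + T, (J.2 i).2 + T)) ⟨fun i hi => ?_, fun i hi j hj hij => ?_⟩
    (by simpa using hs)
  · have := hJ.1 i hi
    simp only [← Set.image_add_const_uIcc]
    exact ⟨mem_image_of_mem _ this.1, mem_image_of_mem _ this.2⟩
  · have := hJ.2 hi hj hij
    simp only [Function.onFun, Set.disjoint_left, Set.mem_uIoc] at this ⊢
    intro x hx hx'
    refine @this (x - T) ?_ ?_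
    · rcases hx with h | h
      · left; constructor <;> linarith [h.1, h.2]
      · right; constructor <;> linarith [h.1, h.2]
    · rcases hx' with h | h
      · left; constructor <;> linarith [h.1, h.2]
      · right; constructor <;> linarith [h.1, h.2]

/-- A mean value inequality for absolutely continuous functions. -/
theorem AbsolutelyContinuousOnInterval.sub_le_mul_of_ae_deriv_le {f : ℝ → ℝ} {a b k : ℝ}
    (hab : a ≤ b) (hf : AbsolutelyContinuousOnInterval f a b)
    (hd : ∀ᵐ t ∂(volume.restrict (Icc a b)), ∃ v, HasDerivAt f v t ∧ v ≤ k) :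
    f b - f a ≤ k * (b - a) := by
  rw [← hf.integral_deriv_eq_sub]
  calc ∫ x in a..b, deriv f x ≤ ∫ x in a..b, k := by
        refine intervalIntegral.integral_mono_ae_restrict hab hf.intervalIntegrable_deriv
          (by simp) ?_
        filter_upwards [hd] with t ⟨v, hv, hk⟩
        rw [hv.deriv]; exact hk
    _ = k * (b - a) := by simp [mul_comm]

/-! ### Differential inequalities for norms, and sweeping by a translated set in a Hilbert norm. -/

section InnerProduct

open Filter Topology RealInnerProductSpace

variable {E : Type*} [NormedAddCommGroup E] [InnerProductSpace ℝ E]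

/-- The derivative of `‖u‖ ^ 2` is `2⟪v, u⟫`; the square avoids the point where the norm is not
differentiable. -/
theorem norm_le_of_ae_inner_deriv_nonpos {u : ℝ → E} {a b : ℝ} (hab : a ≤ b)
    (hu : AbsolutelyContinuousOnInterval u a b)
    (hd : ∀ᵐ t ∂(volume.restrict (Icc a b)), ∃ v, HasDerivAt u v t ∧ ⟪v, u t⟫ ≤ 0) :
    ‖u b‖ ≤ ‖u a‖ := by
  have hn : AbsolutelyContinuousOnInterval (fun t => ‖u t‖) a b :=
    lipschitzWith_one_norm.comp_absolutelyContinuousOnInterval hu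
  have h := (hn.fun_mul hn).sub_le_mul_of_ae_deriv_le (k := 0) hab (by
    filter_upwards [hd] with t ⟨v, hv, hk⟩
    have h2 := hv.norm_sq
    simp only [pow_two] at h2
    refine ⟨_, h2, ?_⟩
    rw [real_inner_comm]; linarith)
  nlinarith [norm_nonneg (u a), norm_nonneg (u b)]

/-- Since the norm is nonincreasing, a zero persists. If `u b ≠ 0`, then `u` has no zero on the
interval, so the norm itself can be differentiated and has slope at most `-k`. -/
theorem eq_zero_or_norm_le_of_ae_inner_deriv_le {u : ℝ → E} {a b k : ℝ} (hab : a ≤ b) (hk : 0 ≤ k)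
    (hu : AbsolutelyContinuousOnInterval u a b)
    (hd : ∀ᵐ t ∂(volume.restrict (Icc a b)), ∃ v, HasDerivAt u v t ∧ ⟪v, u t⟫ ≤ -k * ‖u t‖) :
    u b = 0 ∨ ‖u b‖ ≤ ‖u a‖ - k * (b - a) := by
  by_cases hb : u b = 0
  · exact Or.inl hb
  right
  have hn : AbsolutelyContinuousOnInterval (fun t => ‖u t‖) a b :=
    lipschitzWith_one_norm.comp_absolutelyContinuousOnInterval hu
  have hpos : ∀ t ∈ Icc a b, u t ≠ 0 := by
    intro t ht h0
    have hsub : Icc t b ⊆ Icc a b := Icc_subset_Icc_left ht.1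
    have := norm_le_of_ae_inner_deriv_nonpos ht.2
      (hu.mono (by rwa [uIcc_of_le ht.2, uIcc_of_le hab])) (by
        filter_upwards [ae_restrict_of_ae_restrict_of_subset hsub hd] with s ⟨v, hv, hs⟩
        exact ⟨v, hv, hs.trans (by nlinarith [norm_nonneg (u s)])⟩)
    rw [h0, norm_zero] at this
    exact hb (norm_le_zero_iff.1 this)
  have h := hn.sub_le_mul_of_ae_deriv_le (k := -k) hab (by
    filter_upwards [hd, ae_restrict_mem measurableSet_Icc] with t ⟨v, hv, hk⟩ ht
    have h0 := hpos t ht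
    have h2 := (hv.norm_sq).sqrt (by positivity)
    simp only [Real.sqrt_sq (norm_nonneg _)] at h2
    refine ⟨_, h2, ?_⟩
    have h0' : 0 < ‖u t‖ := norm_pos_iff.2 h0
    rw [div_le_iff₀ (by positivity), real_inner_comm]
    linarith)
  linarith

theorem exists_projection {K : Set E} (hK : IsCompact K) (hc : Convex ℝ K) (hne : K.Nonempty) :
    ∃ p : E → E, ∀ x, p x ∈ K ∧ ∀ ξ ∈ K, ⟪x - p x, ξ - p x⟫ ≤ 0 := by
  have h : ∀ x, ∃ y, y ∈ K ∧ ∀ ξ ∈ K, ⟪x - y, ξ - y⟫ ≤ 0 := by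
    intro x
    obtain ⟨y, hy, h⟩ := exists_norm_eq_iInf_of_complete_convex hne hK.isComplete hc x
    exact ⟨y, hy, (norm_eq_iInf_iff_real_inner_le_zero hc hy).1 h⟩
  choose p hp using h
  exact ⟨p, hp⟩

/-- The catch-up algorithm: the successive positions relative to the moving set. -/
def catchUp (p : E → E) (z₀ : E) (c : ℕ → E) : ℕ → E
  | 0 => z₀
  | k + 1 => p (catchUp p z₀ c k - (c (k + 1) - c k))

/-! ### Catch-up algorithm: discrete estimates and passage to the limit. -/

section CatchUp

variable {K : Set E} {p : E → E} (hp : ∀ x, p x ∈ K ∧ ∀ ξ ∈ K, ⟪x - p x, ξ - p x⟫ ≤ 0)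
  {z₀ : E} (hz₀ : z₀ ∈ K) {c : ℕ → E} {s : ℕ → ℝ} (hs : Monotone s) {L : ℝ} (hL : 0 ≤ L)
  (hc : ∀ k, ‖c (k + 1) - c k‖ ≤ L * (s (k + 1) - s k))

include hp hz₀ in
theorem catchUp_mem (k : ℕ) : catchUp p z₀ c k ∈ K := by
  cases k with
  | zero => exact hz₀
  | succ k => exact (hp _).1

include hp in
-- The discrete sweeping inclusion: a step of the absolute position is `p x - x`, the negative of a
-- normal vector at the new point.
theorem catchUp_inner_le (k : ℕ) {ξ : E} (hξ : ξ ∈ K) :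
    ⟪catchUp p z₀ c (k + 1) + c (k + 1) - (catchUp p z₀ c k + c k),
      catchUp p z₀ c (k + 1) - ξ⟫ ≤ 0 := by
  have h := (hp (catchUp p z₀ c k - (c (k + 1) - c k))).2 ξ hξ
  rw [← inner_neg_neg] at h
  convert h using 2
  · simp only [catchUp]; abel
  · simp only [catchUp]; abel

include hp hz₀ hc in
theorem norm_catchUp_succ_sub_le (k : ℕ) :
    ‖catchUp p z₀ c (k + 1) - catchUp p z₀ c k‖ ≤ L * (s (k + 1) - s k) := by
  refine le_trans ?_ (hc k)
  -- Testing with the previous position gives `‖x‖² ≤ -⟪Δc, x⟫`, hence `‖x‖ ≤ ‖Δc‖`.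
  have h := catchUp_inner_le hp (z₀ := z₀) (c := c) k (catchUp_mem hp hz₀ (c := c) k)
  set x := catchUp p z₀ c (k + 1) - catchUp p z₀ c k with hx
  have e : catchUp p z₀ c (k + 1) + c (k + 1) - (catchUp p z₀ c k + c k)
      = x + (c (k + 1) - c k) := by rw [hx]; abel
  rw [e, inner_add_left, real_inner_self_eq_norm_sq] at h
  have h2 := abs_le.1 (abs_real_inner_le_norm (c (k + 1) - c k) x)
  by_contra! hlt
  nlinarith [norm_nonneg (c (k + 1) - c k), norm_nonneg x]

include hp hz₀ hc in
theorem norm_catchUp_sub_le {i j : ℕ} (hij : i ≤ j) :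
    ‖catchUp p z₀ c j - catchUp p z₀ c i‖ ≤ L * (s j - s i) := by
  induction j, hij using Nat.le_induction with
  | base => simp
  | succ j hij ih =>
    have := norm_sub_le_norm_sub_add_norm_sub (catchUp p z₀ c (j + 1)) (catchUp p z₀ c j)
      (catchUp p z₀ c i)
    linarith [norm_catchUp_succ_sub_le hp hz₀ hc j]

include hp hz₀ hs hL hc in
-- Sums the discrete inclusions with the base point frozen at step `i`. Each replacement of `z (j +
-- 1)` by `z i` costs at most a step length `2L Δs` times a drift `L (s (j + 1) - s i)`, so the
-- total error is quadratic in the elapsed time. No derivative occurs, so the estimate survives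
-- pointwise limits.
theorem catchUp_inner_sub_le {i j : ℕ} (hij : i ≤ j) {ξ : E} (hξ : ξ ∈ K) :
    ⟪catchUp p z₀ c j + c j - (catchUp p z₀ c i + c i), catchUp p z₀ c i - ξ⟫
      ≤ 2 * L ^ 2 * (s j - s i) ^ 2 := by
  induction j, hij using Nat.le_induction with
  | base => simp
  | succ j hij ih =>
    have h1 := catchUp_inner_le hp (z₀ := z₀) (c := c) j hξ
    have h2 := norm_catchUp_sub_le hp hz₀ hc (hij.trans j.le_succ)
    have h3 := norm_catchUp_succ_sub_le hp hz₀ hc j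
    have h4 := hc j
    set z := catchUp p z₀ c
    have e : ⟪z (j + 1) + c (j + 1) - (z i + c i), z i - ξ⟫
        = ⟪z j + c j - (z i + c i), z i - ξ⟫
          + ⟪z (j + 1) + c (j + 1) - (z j + c j), z (j + 1) - ξ⟫
          - ⟪z (j + 1) + c (j + 1) - (z j + c j), z (j + 1) - z i⟫ := by
      simp only [inner_sub_left, inner_sub_right, inner_add_left]; ring
    have h5 := (abs_le.1 (abs_real_inner_le_norm
      (z (j + 1) + c (j + 1) - (z j + c j)) (z (j + 1) - z i))).1
    have h6 : ‖z (j + 1) + c (j + 1) - (z j + c j)‖ ≤ 2 * L * (s (j + 1) - s j) := by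
      have := norm_add_le (z (j + 1) - z j) (c (j + 1) - c j)
      rw [show z (j + 1) + c (j + 1) - (z j + c j) = (z (j + 1) - z j) + (c (j + 1) - c j) by abel]
      linarith
    have hd : 0 ≤ s (j + 1) - s j := sub_nonneg.2 (hs j.le_succ)
    have ha : 0 ≤ s j - s i := sub_nonneg.2 (hs hij)
    have h7 := mul_le_mul h6 h2 (norm_nonneg _) (by positivity)
    have h8 : 0 ≤ L ^ 2 * ((s j - s i) * (s (j + 1) - s j)) := by positivity
    rw [e]
    nlinarith [h7, h8, h5, ih, h1]

end CatchUp

/-- Existence for the sweeping process with a translated convex compact set: `z` is the position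
relative to the moving set `K + c t`. -/
theorem exists_sweeping {K : Set E} (hK : IsCompact K) (hconv : Convex ℝ K) {z₀ : E}
    (hz₀ : z₀ ∈ K) {c : ℝ → E} {L : NNReal} (hc : LipschitzWith L c) :
    ∃ z : ℝ → E, (∀ t, z t ∈ K) ∧ LipschitzOnWith L z (Ici 0) ∧
      ∀ s t, 0 ≤ s → s ≤ t → ∀ ξ ∈ K,
        ⟪z t + c t - (z s + c s), z s - ξ⟫ ≤ 2 * (L : ℝ) ^ 2 * (t - s) ^ 2 := by
  obtain ⟨p, hp⟩ := exists_projection hK hconv ⟨z₀, hz₀⟩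
  let g : ℕ → ℕ → ℝ := fun N k => k / ((N + 1 : ℕ) : ℝ)
  have hg : ∀ N, Monotone (g N) := fun N i j hij => by
    simp only [g]; gcongr
  -- For `t ≥ 0`, the index of the last node of mesh `1 / (N + 1)` not after `t`.
  let q : ℕ → ℝ → ℕ := fun N t => ⌊t * ((N + 1 : ℕ) : ℝ)⌋₊
  have hq : ∀ N, Monotone (q N) := fun N i j hij => by
    simp only [q]; gcongr
  let Z : ℕ → ℝ → E := fun N t => catchUp p z₀ (fun k => c (g N k)) (q N t)
  have hcg : ∀ N k, ‖c (g N (k + 1)) - c (g N k)‖ ≤ L * (g N (k + 1) - g N k) := by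
    intro N k
    have := hc.dist_le_mul (g N (k + 1)) (g N k)
    rwa [dist_eq_norm, Real.dist_eq, abs_of_nonneg (sub_nonneg.2 (hg N k.le_succ))] at this
  -- By compactness of `K`, an ultrafilter gives limits at all times at once, with no extraction of
  -- subsequences.
  let U : Ultrafilter ℕ := hyperfilter ℕ
  have hU : (U : Filter ℕ) ≤ atTop := Nat.hyperfilter_le_atTop
  have hlim : ∀ t, ∃ x ∈ K, Tendsto (fun N => Z N t) U (𝓝 x) := by
    intro t
    exact hK.ultrafilter_le_nhds (U.map fun N => Z N t)
      (by rw [le_principal_iff]; exact Filter.mem_map.2 (Filter.univ_mem' fun N => catchUp_mem hp hz₀ _))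
  choose z hz hzlim using hlim
  have hT : ∀ t, 0 ≤ t → Tendsto (fun N => g N (q N t)) U (𝓝 t) := by
    intro t ht
    have h1 := (tendsto_nat_floor_mul_div_atTop (R := ℝ) ht)
    have h2 : Tendsto (fun N : ℕ => ((N + 1 : ℕ) : ℝ)) atTop atTop :=
      tendsto_natCast_atTop_atTop.comp (tendsto_add_atTop_nat 1)
    exact (h1.comp h2).mono_left hU
  have hlip : ∀ s t, 0 ≤ s → s ≤ t → ‖z t - z s‖ ≤ L * (t - s) := by
    intro s t hs hst
    refine le_of_tendsto_of_tendsto' ((hzlim t).sub (hzlim s)).norm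
      (((hT t (hs.trans hst)).sub (hT s hs)).const_mul (L : ℝ)) fun N => ?_
    exact norm_catchUp_sub_le hp hz₀ (hcg N) (hq N hst)
  refine ⟨z, hz, LipschitzOnWith.of_dist_le_mul fun s hs t ht => ?_, fun s t hs hst ξ hξ => ?_⟩
  · rw [dist_eq_norm, Real.dist_eq]
    rcases le_total s t with h | h
    · rw [norm_sub_rev, abs_sub_comm, abs_of_nonneg (sub_nonneg.2 h)]
      exact hlip s t hs h
    · rw [abs_of_nonneg (sub_nonneg.2 h)]
      exact hlip t s ht h
  · have hcl : ∀ r, 0 ≤ r → Tendsto (fun N => c (g N (q N r))) U (𝓝 (c r)) := fun r hr =>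
      (hc.continuous.tendsto r).comp (hT r hr)
    have ht := hs.trans hst
    refine le_of_tendsto_of_tendsto'
      ((((hzlim t).add (hcl t ht)).sub ((hzlim s).add (hcl s hs))).inner
        ((hzlim s).sub (tendsto_const_nhds (x := ξ))))
      ((((hT t ht).sub (hT s hs)).pow 2).const_mul (2 * (L : ℝ) ^ 2)) fun N => ?_
    exact catchUp_inner_sub_le hp hz₀ (hg N) L.2 (hcg N) (hq N hst) hξ

/-- Dividing by `t - s` and letting `t ↓ s` removes the quadratic error; this recovers the
differential inclusion from the limit of the catch-up estimate. -/
theorem inner_nonpos_of_hasDerivAt {y : ℝ → E} {v x : E} {s M : ℝ} (hy : HasDerivAt y v s)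
    (h : ∀ t, s ≤ t → ⟪y t - y s, x⟫ ≤ M * (t - s) ^ 2) : ⟪v, x⟫ ≤ 0 := by
  have h1 : Tendsto (fun t => ⟪slope y s t, x⟫) (𝓝[>] s) (𝓝 ⟪v, x⟫) :=
    ((hasDerivAt_iff_tendsto_slope.1 hy).mono_left
      (nhdsWithin_mono _ fun t ht => ne_of_gt ht)).inner tendsto_const_nhds
  have h2 : Tendsto (fun t : ℝ => M * (t - s)) (𝓝[>] s) (𝓝 0) := by
    have : Continuous fun t : ℝ => M * (t - s) := by fun_prop
    simpa using (this.tendsto s).mono_left nhdsWithin_le_nhds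
  refine le_of_tendsto_of_tendsto h1 h2 ?_
  filter_upwards [self_mem_nhdsWithin] with t ht
  have hpos : 0 < t - s := sub_pos.2 ht
  rw [slope_def_module, real_inner_smul_left, inv_mul_le_iff₀ hpos]
  nlinarith [h t (le_of_lt ht)]

end InnerProduct

/-! ### Linear algebra of the reduction and the geometry of `C`. -/

namespace ElastoplasticSystem

open Matrix Module Filter Topology

variable {m n : ℕ} {S : ElastoplasticSystem m n}

/-- If `n ≤ 1`, then `D` has rank `0`, against the rank of `DᵀR`. This makes the truncated
subtractions `n - 1` and `n - 2` genuine. -/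
theorem two_le_of_rank (S : ElastoplasticSystem m n) : 2 ≤ n := by
  by_contra! h
  have hr := S.rank_D
  have h0 : S.D.rank = 0 := by omega
  have := rank_mul_le_left S.D.transpose (replicateCol (Fin 1) S.R)
  rw [S.rank_DtR, rank_transpose, h0] at this
  omega

theorem A_mulVec (x : Fin m → ℝ) (j : Fin m) : S.A.mulVec x j = S.a j * x j := by
  simp [A, mulVec_diagonal]

theorem A_inv_mulVec (x : Fin m → ℝ) (j : Fin m) : S.A⁻¹.mulVec x j = (S.a j)⁻¹ * x j := by
  have : S.A⁻¹ = diagonal fun j => (S.a j)⁻¹ := by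
    refine inv_eq_right_inv ?_
    rw [A, diagonal_mul_diagonal, ← diagonal_one]
    congr 1
    funext i
    exact mul_inv_cancel₀ (S.a_pos i).ne'
  rw [this, mulVec_diagonal]

theorem A_inv_mulVec_A (x : Fin m → ℝ) : S.A⁻¹.mulVec (S.A.mulVec x) = x := by
  funext j
  rw [A_inv_mulVec, A_mulVec, inv_mul_cancel_left₀ (S.a_pos j).ne']

theorem A_mulVec_A_inv (x : Fin m → ℝ) : S.A.mulVec (S.A⁻¹.mulVec x) = x := by
  funext j
  rw [A_mulVec, A_inv_mulVec, mul_inv_cancel_left₀ (S.a_pos j).ne']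

theorem innerA_eq_sum (x y : Fin m → ℝ) : S.innerA x y = ∑ j, S.a j * (x j * y j) := by
  simp only [innerA, dotProduct, A_mulVec]
  exact Finset.sum_congr rfl fun j _ => by ring

theorem innerA_add_left (x y z : Fin m → ℝ) :
    S.innerA (x + y) z = S.innerA x z + S.innerA y z := by
  simp [innerA, add_dotProduct]

theorem innerA_smul_left (r : ℝ) (x z : Fin m → ℝ) :
    S.innerA (r • x) z = r * S.innerA x z := by
  simp [innerA, smul_dotProduct]

theorem innerA_sub_left (x y z : Fin m → ℝ) :
    S.innerA (x - y) z = S.innerA x z - S.innerA y z := by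
  simp [innerA, sub_dotProduct]

theorem innerA_comm (x y : Fin m → ℝ) : S.innerA x y = S.innerA y x := by
  simp only [innerA_eq_sum, mul_comm (x _)]

theorem innerA_single_left (j : Fin m) (y : Fin m → ℝ) :
    S.innerA (Pi.single j 1) y = S.A.mulVec y j := by
  simp [innerA]

theorem innerA_self_nonneg (x : Fin m → ℝ) : 0 ≤ S.innerA x x := by
  rw [innerA_eq_sum]
  exact Finset.sum_nonneg fun j _ => mul_nonneg (S.a_pos j).le (mul_self_nonneg _)

theorem eq_zero_of_innerA_self {x : Fin m → ℝ} (h : S.innerA x x ≤ 0) : x = 0 := by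
  have h0 := le_antisymm h (innerA_self_nonneg x)
  rw [innerA_eq_sum, Finset.sum_eq_zero_iff_of_nonneg
    fun j _ => mul_nonneg (S.a_pos j).le (mul_self_nonneg _)] at h0
  funext j
  have := h0 j (Finset.mem_univ j)
  simpa [(S.a_pos j).ne'] using this

theorem normA_nonneg (x : Fin m → ℝ) : 0 ≤ S.normA x := Real.sqrt_nonneg _

theorem normA_smul (r : ℝ) (x : Fin m → ℝ) : S.normA (r • x) = |r| * S.normA x := by
  rw [normA, innerA_smul_left, innerA_comm, innerA_smul_left, ← mul_assoc,
    Real.sqrt_mul (mul_self_nonneg r), Real.sqrt_mul_self_eq_abs, normA]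

theorem normA_neg (x : Fin m → ℝ) : S.normA (-x) = S.normA x := by
  simpa using normA_smul (S := S) (-1) x

namespace Reduction

variable (P : S.Reduction)

theorem range_D_eq_ker : LinearMap.range S.D.mulVecLin = LinearMap.ker P.Dperp.transpose.mulVecLin := by
  have hn := S.two_le_of_rank
  have hnm := S.node_le_spring
  refine Submodule.eq_of_le_of_finrank_eq ?_ ?_
  · rintro _ ⟨w, rfl⟩
    rw [LinearMap.mem_ker, mulVecLin_apply, mulVecLin_apply, mulVec_mulVec, P.Dperp_D, zero_mulVec]
  · have h1 := LinearMap.finrank_range_add_finrank_ker P.Dperp.transpose.mulVecLin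
    have h2 : finrank ℝ (LinearMap.range P.Dperp.transpose.mulVecLin) = m - n + 1 := by
      have := P.rank_Dperp
      rwa [← rank_transpose] at this
    have h3 : finrank ℝ (LinearMap.range S.D.mulVecLin) = n - 1 := S.rank_D
    rw [h2, finrank_fin_fun] at h1
    omega

/-- One inclusion is `RᵀDM = 0`. Since `DᵀR ≠ 0`, the hyperplane `R^⊥` cuts the range of `D`
properly, so the intersection has dimension at most `n - 2`, the rank of `DM`. -/
theorem range_DM_eq : LinearMap.range (S.D * P.M).mulVecLin =
    LinearMap.range S.D.mulVecLin ⊓ LinearMap.ker (dotProductBilin ℝ ℝ S.R) := by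
  have hn := S.two_le_of_rank
  refine Submodule.eq_of_le_of_finrank_le ?_ ?_
  · rintro _ ⟨w, rfl⟩
    refine ⟨⟨P.M.mulVec w, by simp⟩, ?_⟩
    simp only [SetLike.mem_coe, LinearMap.mem_ker, mulVecLin_apply]
    change S.R ⬝ᵥ _ = 0
    rw [dotProduct_mulVec, P.R_DM, zero_dotProduct]
  · have h1 : finrank ℝ (LinearMap.range (S.D * P.M).mulVecLin) = n - 2 := P.rank_DM
    have h3 : finrank ℝ (LinearMap.range S.D.mulVecLin) = n - 1 := S.rank_D
    have hlt : LinearMap.range S.D.mulVecLin ⊓ LinearMap.ker (dotProductBilin ℝ ℝ S.R)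
        < LinearMap.range S.D.mulVecLin := by
      refine lt_of_le_of_ne inf_le_left fun h => ?_
      rw [inf_eq_left] at h
      have hz : S.D.transpose * replicateCol (Fin 1) S.R = 0 := by
        ext i k
        have : S.R ⬝ᵥ S.D.mulVec (Pi.single i 1) = 0 := h ⟨Pi.single i 1, rfl⟩
        rw [mulVec_single_one] at this
        simpa [mul_apply, dotProduct, mul_comm] using this
      have := S.rank_DtR
      rw [hz, rank_zero] at this
      omega
    have := Submodule.finrank_lt_finrank_of_lt hlt
    omega

theorem exists_eq_DM_of_G_eq_zero {x : Fin m → ℝ} (h : P.G.mulVec x = 0) :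
    ∃ w, x = (S.D * P.M).mulVec w := by
  have h0 : S.R ⬝ᵥ x = 0 := congrFun h 0
  have h1 : P.Dperp.transpose.mulVec x = 0 := funext fun i => congrFun h i.succ
  have : x ∈ LinearMap.range (S.D * P.M).mulVecLin := by
    rw [range_DM_eq, range_D_eq_ker]
    exact ⟨h1, h0⟩
  obtain ⟨w, hw⟩ := this
  exact ⟨w, hw.symm⟩

theorem innerA_DM {x : Fin m → ℝ} (hx : x ∈ P.V) (w : Fin (n - 2) → ℝ) :
    S.innerA ((S.D * P.M).mulVec w) x = 0 := by
  obtain ⟨v, rfl⟩ := hx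
  rw [innerA, mulVecLin_apply, mulVec_mulVec, ← vecMul_transpose, ← dotProduct_mulVec,
    mulVec_mulVec, ← Matrix.mul_assoc, P.orth_Vbasis]
  simp

/-- A vector of `V` killed by `G` lies in the range of `DM`, which is `A`-orthogonal to `V`; so it
is orthogonal to itself and vanishes. -/
theorem isUnit_W : IsUnit P.W := by
  rw [← mulVec_injective_iff_isUnit]
  refine (injective_iff_map_eq_zero P.W.mulVecLin).2 fun v hv => ?_
  rw [mulVecLin_apply, W, ← mulVec_mulVec] at hv
  obtain ⟨w, hw⟩ := P.exists_eq_DM_of_G_eq_zero hv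
  have hV : P.Vbasis.mulVec v ∈ P.V := ⟨v, rfl⟩
  have h0 : P.Vbasis.mulVec v = 0 := by
    refine eq_zero_of_innerA_self (S := S) (le_of_eq ?_)
    nth_rewrite 1 [hw]
    exact P.innerA_DM hV w
  have hinj : Function.Injective P.Vbasis.mulVecLin := by
    rw [← LinearMap.ker_eq_bot]
    have h1 := LinearMap.finrank_range_add_finrank_ker P.Vbasis.mulVecLin
    have h2 : finrank ℝ (LinearMap.range P.Vbasis.mulVecLin) = m - n + 2 := P.rank_Vbasis
    rw [h2, finrank_fin_fun] at h1
    exact Submodule.finrank_eq_zero.1 (by omega)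
  exact hinj (by simpa using h0)

theorem normal_mem (j : Fin m) : P.normal j ∈ P.V := ⟨_, rfl⟩

/-- `G` takes the same value at `e_j` and `n_j`, so their difference is in the range of `DM` and is
`A`-orthogonal to `V`: `n_j` is the projection of `e_j`. -/
theorem innerA_normal (j : Fin m) {y : Fin m → ℝ} (hy : y ∈ P.V) :
    S.innerA (P.normal j) y = S.A.mulVec y j := by
  have hG : P.G.mulVec (Pi.single j 1 - P.normal j) = 0 := by
    rw [mulVec_sub, normal, mulVec_mulVec, mulVec_mulVec]
    change _ - (P.W * P.W⁻¹).mulVec _ = 0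
    rw [mul_nonsing_inv _ ((isUnit_iff_isUnit_det _).1 P.isUnit_W), one_mulVec, sub_self]
  obtain ⟨w, hw⟩ := P.exists_eq_DM_of_G_eq_zero hG
  have := P.innerA_DM hy w
  rw [← hw, innerA_sub_left, innerA_single_left] at this
  linarith

theorem isClosed_V : IsClosed (P.V : Set (Fin m → ℝ)) := P.V.closed_of_finiteDimensional

theorem convex_C : Convex ℝ P.C := by
  rintro x ⟨hx, hx'⟩ y ⟨hy, hy'⟩ a b ha hb hab
  refine ⟨P.V.add_mem (P.V.smul_mem _ hx) (P.V.smul_mem _ hy), fun j => ?_⟩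
  have e : S.A.mulVec (a • x + b • y) j = a * S.A.mulVec x j + b * S.A.mulVec y j := by
    simp only [A_mulVec, Pi.add_apply, Pi.smul_apply, smul_eq_mul]; ring
  rw [e]
  exact convex_Icc _ _ (hx' j) (hy' j) ha hb hab

theorem isCompact_C : IsCompact P.C := by
  have hcont : ∀ j, Continuous fun y : Fin m → ℝ => S.A.mulVec y j := fun j => by
    simp only [A_mulVec]; fun_prop
  have hcl : IsClosed P.C := by
    refine P.isClosed_V.inter (s₂ := {y | ∀ j, S.cMinus j ≤ S.A.mulVec y j ∧
      S.A.mulVec y j ≤ S.cPlus j}) ?_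
    simp only [ofPred_forall]
    refine isClosed_iInter fun j => ?_
    exact (isClosed_le continuous_const (hcont j)).inter (isClosed_le (hcont j) continuous_const)
  refine IsCompact.of_isClosed_subset (isCompact_univ_pi (s := fun j =>
    Icc ((S.a j)⁻¹ * S.cMinus j) ((S.a j)⁻¹ * S.cPlus j)) fun j => isCompact_Icc) hcl ?_
  rintro y ⟨-, hy⟩ j -
  have h := hy j
  rw [A_mulVec] at h
  have ha := S.a_pos j
  constructor
  · rw [inv_mul_le_iff₀ ha]; exact h.1
  · rw [le_inv_mul_iff₀ ha]; exact h.2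

theorem normA_sub_le {x y : Fin m → ℝ} (hx : x ∈ P.C) (hy : y ∈ P.C) :
    S.normA (x - y) ≤ S.normA (S.A⁻¹.mulVec S.cPlus - S.A⁻¹.mulVec S.cMinus) := by
  refine Real.sqrt_le_sqrt ?_
  rw [innerA_eq_sum, innerA_eq_sum]
  refine Finset.sum_le_sum fun j _ => mul_le_mul_of_nonneg_left ?_ (S.a_pos j).le
  have ha := S.a_pos j
  have h1 := hx.2 j
  have h2 := hy.2 j
  rw [A_mulVec] at h1 h2
  simp only [Pi.sub_apply, A_inv_mulVec]
  rw [← mul_sub, ← abs_mul_abs_self (x j - y j)]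
  have : |x j - y j| ≤ (S.a j)⁻¹ * (S.cPlus j - S.cMinus j) := by
    rw [le_inv_mul_iff₀ ha, ← abs_of_pos ha, ← abs_mul, abs_le]
    constructor <;> nlinarith
  exact mul_self_le_mul_self (abs_nonneg _) this

/-! ### The cone of active normals at `y₀`. -/

variable {I : Finset (ℤˣ × Fin m)} {y₀ : Fin m → ℝ}

theorem mem_C_of_mem_F (hy₀ : y₀ ∈ P.F I) (hfeas : S.Feasible I y₀) : y₀ ∈ P.C := by
  refine ⟨hy₀.1, fun j => ?_⟩
  by_cases h : ∃ α : ℤˣ, (α, j) ∈ I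
  · obtain ⟨α, hα⟩ := h
    have := hy₀.2 _ hα
    simp only [limit] at this
    rw [this]
    split_ifs
    · exact ⟨S.limits_le j, le_rfl⟩
    · exact ⟨le_rfl, S.limits_le j⟩
  · push Not at h
    exact ⟨(hfeas j h).1.le, (hfeas j h).2.le⟩

theorem cone_subset_V : P.cone I ⊆ P.V := by
  intro x hx
  refine Submodule.span_induction (R := {r : ℝ // 0 ≤ r}) (p := fun x _ => x ∈ P.V) ?_ P.V.zero_mem
    (fun _ _ _ _ => P.V.add_mem) (fun r x _ hx => P.V.smul_mem (r : ℝ) hx) hx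
  rintro _ ⟨p, -, rfl⟩
  exact P.V.smul_mem _ (P.normal_mem _)

theorem innerA_cone_nonpos {w : Fin m → ℝ} (hw : w ∈ P.V)
    (h : ∀ p ∈ I, ((p.1 : ℤ) : ℝ) * S.A.mulVec w p.2 ≤ 0) {x : Fin m → ℝ} (hx : x ∈ P.cone I) :
    S.innerA x w ≤ 0 := by
  refine Submodule.span_induction (R := {r : ℝ // 0 ≤ r}) (p := fun x _ => S.innerA x w ≤ 0) ?_ (by simp [innerA])
    (fun x y _ _ hx hy => ?_) (fun r x _ hx => ?_) hx
  · rintro _ ⟨p, hp, rfl⟩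
    change S.innerA ((((p.1 : ℤˣ) : ℤ) : ℝ) • P.normal p.2) w ≤ 0
    rw [innerA_smul_left, P.innerA_normal _ hw]
    exact h p hp
  · rw [innerA_add_left]; linarith
  · change S.innerA ((r : ℝ) • x) w ≤ 0
    rw [innerA_smul_left]
    exact mul_nonpos_of_nonneg_of_nonpos r.2 hx

theorem cone_subset_normalCone (hy₀ : y₀ ∈ P.F I) (hC : y₀ ∈ P.C) :
    P.cone I ⊆ P.normalCone P.C y₀ := by
  intro x hx
  refine ⟨hC, P.cone_subset_V hx, fun ξ hξ => ?_⟩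
  refine P.innerA_cone_nonpos (P.V.sub_mem hξ.1 hy₀.1) (fun p hp => ?_) hx
  have h1 := hy₀.2 p hp
  have h2 := hξ.2 p.2
  rw [mulVec_sub, Pi.sub_apply, h1, limit]
  rcases Int.units_eq_one_or p.1 with h | h
  · simp [h]; exact h2.2
  · simp [h]; exact h2.1

/-- The difference `w` of two points of `F` is orthogonal to every generator, hence to a cone
containing a ball of `V`; moving the centre along `w` forces `w = 0`. -/
theorem eq_of_mem_F {y : Fin m → ℝ} (hy₀ : y₀ ∈ P.F I) (hy : y ∈ P.F I) {q : Fin m → ℝ} {ε : ℝ}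
    (hε : 0 < ε) (hball : ∀ ζ ∈ P.V, S.normA ζ < ε → q + ζ ∈ P.cone I) : y = y₀ := by
  set w := y - y₀ with hw
  have hwV : w ∈ P.V := P.V.sub_mem hy.1 hy₀.1
  have hz : ∀ p ∈ I, S.A.mulVec w p.2 = 0 := fun p hp => by
    rw [hw, mulVec_sub, Pi.sub_apply, hy.2 p hp, hy₀.2 p hp, sub_self]
  have h1 : ∀ x ∈ P.cone I, S.innerA x w ≤ 0 := fun x hx =>
    P.innerA_cone_nonpos hwV (fun p hp => by rw [hz p hp, mul_zero]) hx
  have h2 : ∀ x ∈ P.cone I, 0 ≤ S.innerA x w := fun x hx => by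
    have := P.innerA_cone_nonpos (w := -w) (P.V.neg_mem hwV)
      (fun p hp => by rw [mulVec_neg, Pi.neg_apply, hz p hp, neg_zero, mul_zero]) hx
    simp only [innerA, mulVec_neg, dotProduct_neg] at this ⊢
    linarith
  have h3 := h2 _ (by simpa using hball 0 P.V.zero_mem (by simpa [normA, innerA] using hε))
  -- The summand `1` keeps the denominator positive without excluding `w = 0`.
  set δ := ε / (2 * (S.normA w + 1)) with hδ
  have hn := normA_nonneg (S := S) w
  have hδ0 : 0 < δ := by positivity
  have h4 := h1 _ (hball (δ • w) (P.V.smul_mem _ hwV) (by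
    rw [normA_smul, abs_of_pos hδ0, hδ, div_mul_eq_mul_div, div_lt_iff₀ (by positivity)]
    nlinarith))
  rw [innerA_add_left, innerA_smul_left] at h4
  have h5 : S.innerA w w ≤ 0 := by nlinarith
  exact sub_eq_zero.1 (eq_zero_of_innerA_self h5)

/-- If `q + ζ` were outside, the segment from `q` would meet the boundary relative to `V` at
distance at most `‖ζ‖^A < ε`. The connected parameter interval supplies the crossing point. -/
theorem add_mem_cone {q : Fin m → ℝ} (hq : q ∈ P.cone I) {ε : ℝ}
    (hdist : ε ≤ S.distA q (P.coneBoundary I)) {ζ : Fin m → ℝ} (hζ : ζ ∈ P.V)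
    (hlt : S.normA ζ < ε) : q + ζ ∈ P.cone I := by
  by_contra hnot
  let f : unitInterval → P.V := fun r =>
    ⟨q + (r : ℝ) • ζ, P.V.add_mem (P.cone_subset_V hq) (P.V.smul_mem _ hζ)⟩
  have hf : Continuous f := by
    refine Continuous.subtype_mk ?_ _
    fun_prop
  let s : Set P.V := Subtype.val ⁻¹' P.cone I
  have hfr : (frontier (f ⁻¹' s)).Nonempty := by
    rw [nonempty_frontier_iff]
    refine ⟨⟨0, ?_⟩, fun h => ?_⟩
    · simpa [f, s] using hq
    · have : (1 : unitInterval) ∈ f ⁻¹' s := h ▸ mem_univ _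
      exact hnot (by simpa [f, s] using this)
  obtain ⟨r, hr⟩ := hfr
  have hr' := hf.frontier_preimage_subset s hr
  have hle : S.distA q (P.coneBoundary I) ≤ S.normA (q - (q + (r : ℝ) • ζ)) := by
    refine csInf_le ⟨0, ?_⟩ ⟨_, ⟨f r, hr', rfl⟩, rfl⟩
    rintro _ ⟨z, -, rfl⟩
    exact normA_nonneg _
  rw [sub_add_cancel_left, normA_neg, normA_smul, abs_of_nonneg r.2.1] at hle
  have := mul_le_mul_of_nonneg_right r.2.2 (normA_nonneg (S := S) ζ)
  linarith

theorem add_mem_normalCone (hy₀ : y₀ ∈ P.F I) (hC : y₀ ∈ P.C) {q : Fin m → ℝ}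
    (hq : q ∈ P.cone I) {ε : ℝ} (hε : 0 < ε) (hdist : ε ≤ S.distA q (P.coneBoundary I))
    {ζ : Fin m → ℝ} (hζ : ζ ∈ P.V) (hle : S.normA ζ ≤ ε) : q + ζ ∈ P.normalCone P.C y₀ := by
  refine ⟨hC, P.V.add_mem (P.cone_subset_V hq) hζ, fun ξ hξ => ?_⟩
  -- The closed ball is reached by shrinking `ζ` into the open one and letting `θ → 1` in the closed
  -- inequality.
  have h : ∀ θ ∈ Ioo (0 : ℝ) 1, S.innerA (q + θ • ζ) (ξ - y₀) ≤ 0 := fun θ hθ => by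
    refine (P.cone_subset_normalCone hy₀ hC (P.add_mem_cone hq hdist (P.V.smul_mem θ hζ) ?_)).2.2
      ξ hξ
    rw [normA_smul, abs_of_pos hθ.1]
    nlinarith [hθ.1, hθ.2]
  simp only [innerA_add_left, innerA_smul_left] at h ⊢
  have hcont : Continuous fun θ : ℝ => S.innerA q (ξ - y₀) + θ * S.innerA ζ (ξ - y₀) := by fun_prop
  have ht := (hcont.tendsto 1).mono_left (nhdsWithin_le_nhds (s := Iio (1 : ℝ)))
  have := le_of_tendsto ht (by
    filter_upwards [Ioo_mem_nhdsLT (zero_lt_one' ℝ)] with θ hθ using h θ hθ)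
  simpa using this

/-- The linear map `Vbasis W⁻¹` carries `G (α e_j)` to `α n_j` and `e₀` to `Vbasis Lbar`. -/
theorem deriv_smul_mem_cone {t : ℝ} (h : P.LoadingInCone I t) :
    deriv S.l t • P.Vbasis.mulVec P.Lbar ∈ P.cone I := by
  let f : (Fin (m - n + 2) → ℝ) →ₗ[ℝ] (Fin m → ℝ) := P.Vbasis.mulVecLin ∘ₗ P.W⁻¹.mulVecLin
  have key : ∀ x ∈ PointedCone.hull ℝ ((fun p : ℤˣ × Fin m =>
      P.G.mulVec (((p.1 : ℤ) : ℝ) • (Pi.single p.2 1 : Fin m → ℝ))) '' I), f x ∈ P.cone I := by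
    intro x hx
    refine Submodule.span_induction (p := fun x _ => f x ∈ P.cone I) ?_ ?_ ?_ ?_ hx
    · rintro _ ⟨p, hp, rfl⟩
      refine PointedCone.subset_hull ⟨p, hp, ?_⟩
      simp only [mulVec_smul, map_smul]
      rfl
    · rw [map_zero]; exact Submodule.zero_mem _
    · intro x y _ _ hx hy
      rw [map_add]; exact Submodule.add_mem _ hx hy
    · intro r x _ hx
      have : f (r • x) = r • f x := f.map_smul (r : ℝ) x
      rw [this]; exact Submodule.smul_mem _ r hx
  have := key _ h
  rwa [map_smul] at this

end Reduction

end ElastoplasticSystem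

/-! ### Solutions of the sweeping process: contraction, existence and finite-time arrival. -/

namespace ElastoplasticSystem

open Matrix Filter Topology RealInnerProductSpace

noncomputable section

variable {m n : ℕ} (S : ElastoplasticSystem m n)

/-- The isomorphism that turns `⟨x, A y⟩` into the standard scalar product. -/
def euclideanEquiv : (Fin m → ℝ) ≃L[ℝ] EuclideanSpace ℝ (Fin m) :=
  LinearEquiv.toContinuousLinearEquiv
    { toFun := fun x => WithLp.toLp 2 fun j => Real.sqrt (S.a j) * x j
      invFun := fun x j => (Real.sqrt (S.a j))⁻¹ * x j
      map_add' := fun x y => by ext j; simp [mul_add]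
      map_smul' := fun r x => by ext j; simp [mul_left_comm]
      left_inv := fun x => by
        funext j
        simp [inv_mul_cancel_left₀ (Real.sqrt_pos.2 (S.a_pos j)).ne']
      right_inv := fun x => by
        ext j
        simp [mul_inv_cancel_left₀ (Real.sqrt_pos.2 (S.a_pos j)).ne'] }

theorem euclideanEquiv_apply (x : Fin m → ℝ) (j : Fin m) :
    S.euclideanEquiv x j = Real.sqrt (S.a j) * x j := rfl

theorem inner_euclideanEquiv (x y : Fin m → ℝ) :
    ⟪S.euclideanEquiv x, S.euclideanEquiv y⟫ = S.innerA x y := by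
  rw [innerA_eq_sum, PiLp.inner_apply]
  refine Finset.sum_congr rfl fun j _ => ?_
  simp only [euclideanEquiv_apply, RCLike.inner_apply, conj_trivial]
  calc _ = (Real.sqrt (S.a j) * Real.sqrt (S.a j)) * (x j * y j) := by ring
    _ = _ := by rw [Real.mul_self_sqrt (S.a_pos j).le]

theorem norm_euclideanEquiv (x : Fin m → ℝ) : ‖S.euclideanEquiv x‖ = S.normA x := by
  rw [normA, ← inner_euclideanEquiv, real_inner_self_eq_norm_sq, Real.sqrt_sq (norm_nonneg _)]

variable {S}

theorem normA_eq_zero {x : Fin m → ℝ} (h : S.normA x = 0) : x = 0 := by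
  rw [← norm_euclideanEquiv, norm_eq_zero] at h
  exact S.euclideanEquiv.map_eq_zero_iff.1 h

theorem absolutelyContinuousOnInterval_euclideanEquiv {u : ℝ → Fin m → ℝ} {a b : ℝ}
    (hu : AbsolutelyContinuousOnInterval u a b) :
    AbsolutelyContinuousOnInterval (fun t => S.euclideanEquiv (u t)) a b :=
  S.euclideanEquiv.lipschitz.comp_absolutelyContinuousOnInterval hu

theorem hasDerivAt_euclideanEquiv {u : ℝ → Fin m → ℝ} {v : Fin m → ℝ} {t : ℝ}
    (hu : HasDerivAt u v t) :
    HasDerivAt (fun t => S.euclideanEquiv (u t)) (S.euclideanEquiv v) t :=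
  S.euclideanEquiv.toContinuousLinearMap.hasFDerivAt.comp_hasDerivAt t hu

namespace Reduction

variable (P : S.Reduction)

theorem c_mem (t : ℝ) : P.c t ∈ P.V := P.V.neg_mem (P.V.smul_mem _ ⟨_, rfl⟩)

theorem exists_lipschitzOnWith_c : ∃ K : NNReal, LipschitzOnWith K P.c (Ici 0) := by
  obtain ⟨K, hK⟩ := S.lipschitz_l
  refine ⟨K * ‖P.Vbasis.mulVec P.Lbar‖₊, LipschitzOnWith.of_dist_le_mul fun s hs t ht => ?_⟩
  rw [dist_eq_norm, c, c, neg_sub_neg, ← sub_smul, norm_smul, norm_sub_rev, ← dist_eq_norm]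
  have := mul_le_mul_of_nonneg_right (hK.dist_le_mul s hs t ht)
    (norm_nonneg (P.Vbasis.mulVec P.Lbar))
  refine this.trans (le_of_eq ?_)
  push_cast
  ring

theorem ae_hasDerivAt_c : ∀ᵐ t ∂(volume.restrict (Ici 0)),
    HasDerivAt P.c (deriv P.c t) t ∧ -deriv P.c t = deriv S.l t • P.Vbasis.mulVec P.Lbar := by
  obtain ⟨K, hK⟩ := S.lipschitz_l
  have h := hK.ae_differentiableWithinAt (μ := volume) measurableSet_Ici
  -- Dropping the null endpoint turns one-sided differentiability within `[0, ∞)` into a two-sided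
  -- derivative.
  rw [← restrict_Ioi_eq_restrict_Ici] at h ⊢
  filter_upwards [h, ae_restrict_mem measurableSet_Ioi] with t ht ht0
  have hl := (ht.differentiableAt (Ici_mem_nhds ht0)).hasDerivAt
  have hc : HasDerivAt P.c (-(deriv S.l t • P.Vbasis.mulVec P.Lbar)) t :=
    (hl.smul_const (P.Vbasis.mulVec P.Lbar)).neg
  rw [hc.deriv, neg_neg]
  exact ⟨hc, rfl⟩

variable {P}

theorem IsSolution.mono {t₀ t₁ : ℝ} {y : ℝ → Fin m → ℝ} (hy : P.IsSolution t₀ y) (h : t₀ ≤ t₁) :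
    P.IsSolution t₁ y where
  absCont b hb := (hy.absCont b (h.trans hb)).mono (by
    rw [uIcc_of_le hb, uIcc_of_le (h.trans hb)]; exact Icc_subset_Icc_left h)
  mem t ht := hy.mem t (h.trans ht)
  inclusion := ae_restrict_of_ae_restrict_of_subset (Ici_subset_Ici.2 h) hy.inclusion

theorem IsSolution.sub_c_mem {t₀ t : ℝ} {y : ℝ → Fin m → ℝ} (hy : P.IsSolution t₀ y)
    (h : t₀ ≤ t) : y t - P.c t ∈ P.C := by
  obtain ⟨x, hx, hxy⟩ := hy.mem t h
  rw [← hxy]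
  simpa using hx

theorem mem_Ct_iff {t : ℝ} {x : Fin m → ℝ} : x ∈ P.Ct t ↔ x - P.c t ∈ P.C := by
  constructor
  · rintro ⟨x, hx, rfl⟩
    simpa using hx
  · exact fun h => ⟨_, h, by simp⟩

/-- The sweeping process is nonexpansive. -/
theorem IsSolution.normA_sub_le {t₀ s t : ℝ} {y z : ℝ → Fin m → ℝ} (hy : P.IsSolution t₀ y)
    (hz : P.IsSolution t₀ z) (hs : t₀ ≤ s) (hst : s ≤ t) :
    S.normA (z t - y t) ≤ S.normA (z s - y s) := by
  have hy := hy.mono hs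
  have hz := hz.mono hs
  rw [← norm_euclideanEquiv, ← norm_euclideanEquiv]
  refine norm_le_of_ae_inner_deriv_nonpos (u := fun t => S.euclideanEquiv (z t - y t)) hst
    (absolutelyContinuousOnInterval_euclideanEquiv
      ((hz.absCont t hst).fun_sub (hy.absCont t hst))) ?_
  filter_upwards [ae_restrict_of_ae_restrict_of_subset Icc_subset_Ici_self hy.inclusion,
    ae_restrict_of_ae_restrict_of_subset Icc_subset_Ici_self hz.inclusion]
    with r ⟨v, hv, hv'⟩ ⟨w, hw, hw'⟩
  refine ⟨_, hasDerivAt_euclideanEquiv (hw.sub hv), ?_⟩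
  rw [inner_euclideanEquiv]
  have h1 := hv'.2.2 _ hw'.1
  have h2 := hw'.2.2 _ hv'.1
  rw [← neg_sub, innerA, mulVec_neg, dotProduct_neg, neg_dotProduct, neg_neg] at h2
  rw [innerA, neg_dotProduct] at h1
  rw [innerA, sub_dotProduct]
  linarith

theorem IsSolution.eq_of_eq {t₀ s t : ℝ} {y z : ℝ → Fin m → ℝ} (hy : P.IsSolution t₀ y)
    (hz : P.IsSolution t₀ z) (hs : t₀ ≤ s) (hst : s ≤ t) (h : z s = y s) : z t = y t := by
  have := hy.normA_sub_le hz hs hst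
  rw [h, sub_self (y s), ← norm_euclideanEquiv S 0, map_zero, norm_zero] at this
  exact sub_eq_zero.1 (normA_eq_zero (le_antisymm this (normA_nonneg _)))

theorem IsSolution.comp_add_const {T : ℝ} (hT : 0 ≤ T) (hc : ∀ t, 0 ≤ t → P.c (t + T) = P.c t)
    {y : ℝ → Fin m → ℝ} (hy : P.IsSolution 0 y) : P.IsSolution 0 fun t => y (t + T) := by
  have hCt : ∀ t, 0 ≤ t → P.Ct (t + T) = P.Ct t := fun t ht => by rw [Ct, Ct, hc t ht]
  refine ⟨fun b hb => ?_, fun t ht => ?_, ?_⟩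
  · refine AbsolutelyContinuousOnInterval.comp_add_const T ?_
    refine (hy.absCont (b + T) (by positivity)).mono ?_
    rw [uIcc_of_le (by linarith), uIcc_of_le (by linarith)]
    exact Icc_subset_Icc_left (by linarith)
  · rw [← hCt t ht]
    exact hy.mem _ (by positivity)
  · have h := hy.inclusion
    rw [ae_restrict_iff' measurableSet_Ici] at h ⊢
    filter_upwards [(measurePreserving_add_right volume T).quasiMeasurePreserving.ae h] with t ht ht0
    obtain ⟨v, hv, hv'⟩ := ht (add_nonneg ht0 hT)
    refine ⟨v, hv.comp_add_const t T, ?_⟩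
    rwa [hCt t ht0] at hv'

/-- No initial value is prescribed: a single solution suffices, since under the loading hypotheses
all solutions merge. -/
theorem exists_isSolution (hne : P.C.Nonempty) : ∃ y, P.IsSolution 0 y := by
  obtain ⟨x₀, hx₀⟩ := hne
  set Φ := S.euclideanEquiv with hΦ
  obtain ⟨K, hK⟩ := P.exists_lipschitzOnWith_c
  -- `c` is Lipschitz only on `[0, ∞)`; freezing it at `c 0` for negative times gives a globally
  -- Lipschitz extension.
  have hmax : LipschitzWith 1 fun t : ℝ => max t 0 := LipschitzWith.id.max_const 0
  obtain ⟨L, hcL⟩ : ∃ L, LipschitzWith L fun t => Φ (P.c (max t 0)) := by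
    have hcm : LipschitzOnWith (K * 1) (fun t => P.c (max t 0)) univ :=
      hK.comp hmax.lipschitzOnWith fun t _ => le_max_right t 0
    exact ⟨_, Φ.lipschitz.comp (lipschitzOnWith_univ.1 hcm)⟩
  obtain ⟨z, hzK, hzL, hz⟩ := exists_sweeping (P.isCompact_C.image Φ.continuous)
    (P.convex_C.linear_image Φ.toLinearEquiv.toLinearMap) (mem_image_of_mem Φ hx₀) hcL
  let y : ℝ → Fin m → ℝ := fun t => Φ.symm (z t) + P.c t
  have hΦy : ∀ t, 0 ≤ t → Φ (y t) = z t + Φ (P.c (max t 0)) := fun t ht => by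
    simp [y, max_eq_left ht]
  have hyC : ∀ t, y t - P.c t ∈ P.C := fun t => by
    obtain ⟨x, hx, hxz⟩ := hzK t
    simpa [y, ← hxz] using hx
  have hyV : ∀ t, y t ∈ P.V := fun t => by
    have := P.V.add_mem (hyC t).1 (P.c_mem t)
    simpa using this
  have hyL := (Φ.symm.lipschitz.comp_lipschitzOnWith hzL).add hK
  refine ⟨y, fun b hb => ?_, fun t _ => mem_Ct_iff.2 (hyC t), ?_⟩
  · refine (hyL.mono ?_).absolutelyContinuousOnInterval
    rw [uIcc_of_le hb]; exact Icc_subset_Ici_self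
  · have h := hyL.ae_differentiableWithinAt (μ := volume) measurableSet_Ici
    rw [← restrict_Ioi_eq_restrict_Ici] at h ⊢
    filter_upwards [h, ae_restrict_mem measurableSet_Ioi] with t ht ht0
    have ht0' : 0 ≤ t := le_of_lt ht0
    have hd : HasDerivAt y (deriv y t) t :=
      (DifferentiableWithinAt.differentiableAt ht (Ici_mem_nhds ht0)).hasDerivAt
    refine ⟨_, hd, mem_Ct_iff.2 (hyC t), P.V.neg_mem ?_, fun ξ hξ => ?_⟩
    · refine P.isClosed_V.mem_of_tendsto (hasDerivAt_iff_tendsto_slope.1 hd)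
        (Eventually.of_forall fun s => ?_)
      exact P.V.smul_mem _ (P.V.sub_mem (hyV s) (hyV t))
    · have hin : ⟪Φ (deriv y t), z t - Φ (ξ - P.c t)⟫ ≤ 0 := by
        refine inner_nonpos_of_hasDerivAt (hasDerivAt_euclideanEquiv (S := S) hd)
          (M := 2 * (L : ℝ) ^ 2) fun s hs => ?_
        rw [← hΦ, hΦy s (ht0'.trans hs), hΦy t ht0']
        exact hz t s ht0' hs _ (mem_image_of_mem Φ (mem_Ct_iff.1 hξ))
      have e : z t - Φ (ξ - P.c t) = Φ (y t - ξ) := by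
        rw [map_sub, map_sub, hΦy t ht0', max_eq_left ht0']; abel
      rw [e, hΦ, inner_euclideanEquiv] at hin
      rw [← neg_sub, innerA, mulVec_neg, dotProduct_neg, neg_dotProduct, neg_neg]
      exact hin

/-- Solutions reach a point at which the normal cone contains a ball around `-c'`. -/
theorem IsSolution.eq_add_c {τ ε : ℝ} (hε : 0 < ε) (hτ0 : 0 ≤ τ) {y₀ : Fin m → ℝ} (hy₀ : y₀ ∈ P.C)
    (hτ : 1 / ε * S.normA (S.A⁻¹.mulVec S.cPlus - S.A⁻¹.mulVec S.cMinus) ≤ τ)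
    (hball : ∀ᵐ t ∂(volume.restrict (Icc 0 τ)), ∀ ζ ∈ P.V, S.normA ζ ≤ ε →
      -deriv P.c t + ζ ∈ P.normalCone P.C y₀)
    {y : ℝ → Fin m → ℝ} (hy : P.IsSolution 0 y) : y τ = y₀ + P.c τ := by
  set Φ := S.euclideanEquiv with hΦ
  obtain ⟨K, hK⟩ := P.exists_lipschitzOnWith_c
  have hcAC : AbsolutelyContinuousOnInterval P.c 0 τ :=
    (hK.mono (by rw [uIcc_of_le hτ0]; exact Icc_subset_Ici_self)).absolutelyContinuousOnInterval
  have hconst : AbsolutelyContinuousOnInterval (fun _ : ℝ => y₀) 0 τ :=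
    (LipschitzWith.const y₀).lipschitzOnWith.absolutelyContinuousOnInterval
  have key := eq_zero_or_norm_le_of_ae_inner_deriv_le
    (u := fun t => Φ (y t - P.c t - y₀)) hτ0 hε.le
    (absolutelyContinuousOnInterval_euclideanEquiv
      (((hy.absCont τ hτ0).fun_sub hcAC).fun_sub hconst)) (by
    filter_upwards [hball, ae_restrict_mem measurableSet_Icc,
      ae_restrict_of_ae_restrict_of_subset Icc_subset_Ici_self hy.inclusion,
      ae_restrict_of_ae_restrict_of_subset Icc_subset_Ici_self P.ae_hasDerivAt_c]
      with t hb ht ⟨v, hv, hv'⟩ ⟨hc, _⟩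
    refine ⟨_, hasDerivAt_euclideanEquiv ((hv.sub hc).sub_const y₀), ?_⟩
    rw [← hΦ]
    set x := y t - P.c t with hx
    have hxC : x ∈ P.C := hy.sub_c_mem ht.1
    have h1 := hv'.2.2 (y₀ + P.c t) (mem_Ct_iff.2 (by simpa using hy₀))
    have e : y₀ + P.c t - y t = -(x - y₀) := by rw [hx]; abel
    rw [e, innerA, mulVec_neg, dotProduct_neg, neg_dotProduct, neg_neg] at h1
    by_cases h0 : x - y₀ = 0
    · simp [h0]
    have hn : 0 < S.normA (x - y₀) :=
      lt_of_le_of_ne (normA_nonneg _) fun h => h0 (normA_eq_zero h.symm)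
    -- The ball element of length `ε` along `x - y₀` gives `⟨-c', x - y₀⟩_A ≤ -ε ‖x - y₀‖^A`; added
    -- to `h1` this is the decay rate.
    have h2 := (hb ((ε / S.normA (x - y₀)) • (x - y₀)) (P.V.smul_mem _ (P.V.sub_mem hxC.1 hy₀.1))
      (by rw [normA_smul, abs_of_pos (by positivity), div_mul_cancel₀ _ hn.ne'])).2.2 x hxC
    have hsq : S.innerA (x - y₀) (x - y₀) = S.normA (x - y₀) * S.normA (x - y₀) := by
      rw [normA, Real.mul_self_sqrt (innerA_self_nonneg _)]
    rw [innerA_add_left, innerA_smul_left, hsq, ← mul_assoc, div_mul_cancel₀ _ hn.ne', innerA,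
      neg_dotProduct] at h2
    rw [hΦ, inner_euclideanEquiv, norm_euclideanEquiv, innerA, sub_dotProduct]
    linarith)
  have hend : y τ - P.c τ - y₀ = 0 := by
    rcases key with h | h
    · exact Φ.map_eq_zero_iff.1 h
    · have h0 := P.normA_sub_le (hy.sub_c_mem le_rfl) hy₀
      rw [one_div, inv_mul_le_iff₀ hε] at hτ
      rw [hΦ, norm_euclideanEquiv, norm_euclideanEquiv] at h
      exact normA_eq_zero (le_antisymm (by linarith) (normA_nonneg _))
  rw [← sub_eq_zero, ← hend]
  abel

end Reduction

end

end ElastoplasticSystem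

/-- With equal limits no strict inequality can hold, so every spring occurs in `I` and all stresses
are fixed. This covers `τ = 0`. -/
theorem ElastoplasticSystem.eq_of_mem_F_of_limits_eq {m n : ℕ} {S : ElastoplasticSystem m n}
    {P : S.Reduction} {I : Finset (ℤˣ × Fin m)} {y₀ y : Fin m → ℝ} (hy₀ : y₀ ∈ P.F I)
    (hy : y ∈ P.F I) (hfeas : S.Feasible I y₀) (h : S.cPlus = S.cMinus) : y = y₀ := by
  have hA : S.A.mulVec y = S.A.mulVec y₀ := by
    funext j
    have : ∃ α : ℤˣ, (α, j) ∈ I := by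
      by_contra! hj
      have := hfeas j hj
      rw [h] at this
      linarith [this.1, this.2]
    obtain ⟨α, hα⟩ := this
    exact (hy.2 _ hα).trans (hy₀.2 _ hα).symm
  rw [← A_inv_mulVec_A (S := S) y, hA, A_inv_mulVec_A]

/-! ### Assembly of the three conclusions. -/

open ElastoplasticSystem ElastoplasticSystem.Reduction in
theorem proposition5 {m n : ℕ} (S : ElastoplasticSystem m n) (P : S.Reduction)
    (I₀ : Finset (ℤˣ × Fin m)) (hI₀ : I₀.card = m - n + 2)
    (y₀ : Fin m → ℝ) (hy₀ : y₀ ∈ P.F I₀) (hfeas : S.Feasible I₀ y₀)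
    (τ ε₀ : ℝ) (hε₀ : 0 < ε₀)
    (hstep1 : ∀ᵐ t ∂(volume.restrict (Icc 0 τ)), P.LoadingInCone I₀ t)
    (hdist : ∀ᵐ t ∂(volume.restrict (Icc 0 τ)),
      ε₀ ≤ S.distA (-deriv P.c t) (P.coneBoundary I₀))
    (hτ : 1 / ε₀ * S.normA (S.A⁻¹.mulVec S.cPlus - S.A⁻¹.mulVec S.cMinus) ≤ τ) :
    P.F I₀ = {y₀} ∧
    P.BallCondition (P.F I₀) ε₀ τ ∧
    (∀ y, P.IsSolution 0 y → y τ = y₀ + P.c τ) ∧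
    (∀ s, P.IsStress 0 s → s τ = S.A.mulVec y₀) ∧
    (∀ T, 0 < T → τ ≤ T → (∀ t, 0 ≤ t → P.c (t + T) = P.c t) →
      (∃ yStar, P.IsOnePeriodStable T yStar ∧
        yStar τ = y₀ + P.c τ ∧
        (∀ z, P.IsSolution τ z → z τ = y₀ + P.c τ → ∀ t, τ ≤ t → z t = yStar t) ∧
        (∀ z, P.IsSolution 0 z → ∀ t, τ ≤ t → z t = yStar t) ∧
        (∀ z, P.IsSolution 0 z → (∀ t, 0 ≤ t → z (t + T) = z t) →
          ∀ t, 0 ≤ t → z t = yStar t)) ∧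
      (∃ sStar, P.IsStress 0 sStar ∧ (∀ t, 0 ≤ t → sStar (t + T) = sStar t) ∧
        (∀ s, P.IsStress 0 s → ∀ t, τ ≤ t → s t = sStar t))) := by
  have hN := normA_nonneg (S := S) (S.A⁻¹.mulVec S.cPlus - S.A⁻¹.mulVec S.cMinus)
  have hτ0 : 0 ≤ τ := le_trans (by positivity) hτ
  have hC := P.mem_C_of_mem_F hy₀ hfeas
  have hcone : ∀ᵐ t ∂(volume.restrict (Icc 0 τ)), -deriv P.c t ∈ P.cone I₀ := by
    filter_upwards [hstep1,
      ae_restrict_of_ae_restrict_of_subset Icc_subset_Ici_self P.ae_hasDerivAt_c] with t h1 h2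
    rw [h2.2]
    exact P.deriv_smul_mem_cone h1
  have hball : ∀ᵐ t ∂(volume.restrict (Icc 0 τ)), ∀ ζ ∈ P.V, S.normA ζ ≤ ε₀ →
      -deriv P.c t + ζ ∈ P.normalCone P.C y₀ := by
    filter_upwards [hcone, hdist] with t h1 h2 ζ hζ hle
    exact P.add_mem_normalCone hy₀ hC h1 hε₀ h2 hζ hle
  have hF : P.F I₀ = {y₀} := by
    refine Subset.antisymm (fun y hy => ?_) (singleton_subset_iff.2 hy₀)
    -- For `τ = 0` the almost-everywhere hypotheses are void, but the bound on `τ` forces `c⁺ = c⁻`;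
    -- for `τ > 0` one good time `t` suffices.
    rcases hτ0.eq_or_lt with h0 | hpos
    · refine eq_of_mem_F_of_limits_eq hy₀ hy hfeas ?_
      rw [← h0, one_div, inv_mul_le_iff₀ hε₀, mul_zero] at hτ
      have := congrArg S.A.mulVec (sub_eq_zero.1 (normA_eq_zero (le_antisymm hτ hN)))
      rwa [A_mulVec_A_inv, A_mulVec_A_inv] at this
    · have : (ae (volume.restrict (Icc 0 τ))).NeBot := by
        rw [ae_neBot, Ne, Measure.restrict_eq_zero, Real.volume_Icc]
        simpa using hpos
      obtain ⟨t, h1, h2⟩ := (hcone.and hdist).exists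
      exact P.eq_of_mem_F hy₀ hy hε₀ fun ζ hζ hlt => P.add_mem_cone h1 h2 hζ hlt
  have hreach : ∀ y, P.IsSolution 0 y → y τ = y₀ + P.c τ := fun y hy =>
    hy.eq_add_c hε₀ hτ0 hC hτ hball
  refine ⟨hF, ?_, hreach, fun s hs => ?_, fun T hT hτT hper => ?_⟩
  · filter_upwards [hball] with t ht y hy ζ hζ hle
    rw [hF] at hy
    rw [mem_singleton_iff.1 hy]
    exact ht ζ hζ.2.1 hle
  · have := add_right_cancel (hreach _ hs)
    rw [← this, A_mulVec_A_inv]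
  · obtain ⟨w, hw⟩ := exists_isSolution (P := P) ⟨y₀, hC⟩
    -- `w` itself may fail to be periodic before `τ`; shifting by `T ≥ τ` discards that transient.
    have hY : P.IsSolution 0 fun t => w (t + T) := hw.comp_add_const hT.le hper
    have hmerge : ∀ z, P.IsSolution 0 z → ∀ t, τ ≤ t → z t = w (t + T) := fun z hz t ht =>
      hY.eq_of_eq hz hτ0 ht ((hreach z hz).trans (hreach _ hY).symm)
    have hYper : ∀ t, 0 ≤ t → w (t + T + T) = w (t + T) := fun t ht =>
      (hmerge w hw (t + T) (by linarith)).symm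
    -- Lyapunov stability holds with `δ = η` by nonexpansiveness.
    refine ⟨⟨fun t => w (t + T), ⟨hY, hYper, fun t₀ ht₀ η hη => ⟨η, hη, fun z hz hlt t ht => ?_⟩,
      fun z hz t ht => hmerge z hz t (hτT.trans ht)⟩, hreach _ hY, fun z hz hzτ t ht => ?_,
      hmerge, fun z hz hzper t ht => ?_⟩, fun t => S.A.mulVec (w (t + T) - P.c t), ?_, ?_, ?_⟩
    · exact ((hY.mono ht₀).normA_sub_le hz le_rfl ht).trans_lt hlt
    · exact (hY.mono hτ0).eq_of_eq hz le_rfl ht (hzτ.trans (hreach _ hY).symm)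
    · change z t = w (t + T)
      rw [← hzper t ht, hmerge z hz (t + T) (by linarith), hYper t ht]
    · simpa only [IsStress, A_inv_mulVec_A, sub_add_cancel] using hY
    · intro t ht
      simp only [hYper t ht, hper t ht]
    · intro s hs t ht
      have := hmerge _ hs t ht
      beta_reduce at this ⊢
      rw [← this, add_sub_cancel_right, A_mulVec_A_inv]
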